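/- A signature $(\mathbb L,\mathbb U)$ consists of a collection $\mathbb L$ of predicates and function symbols of various arities and a nonempty collection $\mathbb U$ of nonempty subsets of $\mathbb N$; it is countable if $\mathbb L$ and $\mathbb U$ are countable. Formulas are built from atomic formulas $t_1=t_2$ and $Pt_1\dots t_n$ (the $t_i$ being terms built from the individual variables $v_0,v_1,\dots$ and the function symbols) by $\neg$, $\wedge$, $\exists x$ and a binary connective $\succeq_X$ for each $X\in\mathbb U$. A sentence is a formula without free variables. A preorder model $\mathcal M=\langle D,\mathbb W,t,\unrhd,s\rangle$ consists of a nonempty domain $D$, a nonempty set $\mathbb W$ of worlds, a map $t$ giving for each $w\in\mathbb W$ each symbol of $\mathbb L$ an interpretation $t(w,\cdot)$ over $D$, a reflexive, transitive and total relation $\unrhd_X$ on $\mathbb W$ for each $X\in\mathbb U$, and a function $s$ with $s(w,A)\in A$ for all $w\in\mathbb W$ and $\emptyset\ne A\subseteq\mathbb W$. For an assignment $d$ of elements of $D$ to the variables, the proposition $\varphi[\mathcal M,d]\subseteq\mathbb W$ is defined by recursion on $\varphi$: an atomic formula expresses the set of worlds $w$ at which it holds under $d$ and $t(w,\cdot)$,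 with $=$ read as identity; $\neg$ is complement in $\mathbb W$ and $\wedge$ is intersection; $(\exists x\psi)[\mathcal M,d]$ is the union of the sets $\psi[\mathcal M,d']$ over all $d'$ that agree with $d$ except possibly at $x$; and $(\theta\succeq_X\psi)[\mathcal M,d]$ is empty if $\theta[\mathcal M,d]$ or $\psi[\mathcal M,d]$ is empty, and otherwise it is $\{w\in\mathbb W : s(w,\theta[\mathcal M,d])\unrhd_X s(w,\psi[\mathcal M,d])\}$. Write $\mathcal M\models\varphi$ if $\varphi[\mathcal M,d]=\mathbb W$ for every $d$. Proposition 4.6. Let $\mathcal M=\langle D,\mathbb W,t,\unrhd,s\rangle$ be a preorder model for a countable signature. (1) If $\mathbb W$ is infinite, then for every infinite cardinal $\kappa$ there is a preorder model $\mathcal M'=\langle D',\mathbb W',t',\unrhd',s'\rangle$ for the same signature such that $\mathrm{card}(\mathbb W')=\kappa$ and, for every sentence $\varphi$, $\mathcal M\models\varphi$ if and only if $\mathcal M'\models\varphi$. (2) If $D$ is infinite, then for every infinite cardinal $\kappa$ there is a preorder model $\mathcal M'=\langle D',\mathbb W',t',\unrhd',s'\rangle$ for the same signature such that $\mathrm{card}(D')=\kappa$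 and, for every sentence $\varphi$, $\mathcal M\models\varphi$ if and only if $\mathcal M'\models\varphi$. -/

import Mathlib

universe u v wD wW w

namespace QuantPref

/-- A signature: a vocabulary of predicates and function symbols of various arities, and a nonempty
collection of nonempty sets of natural numbers (the utility indices). -/
structure Signature where
  vocab : FirstOrder.Language.{u, v}
  indices : Set (Set ℕ)
  indices_nonempty : indices.Nonempty
  nonempty_of_mem : ∀ X ∈ indices, X.Nonempty

/-- A signature is countable if its vocabulary and its collection of utility indices are. -/
def Signature.IsCountable (S : Signature.{u, v}) : Prop :=
  Countable S.vocab.Symbols ∧ S.indices.Countable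

/-- Formulas over a signature. The individual variables `v₀, v₁, …` are the natural numbers, and
terms are built from variables and function symbols. -/
inductive Formula (S : Signature.{u, v}) : Type (max u v) where
  | equal (t₁ t₂ : S.vocab.Term ℕ) : Formula S
  | rel {n : ℕ} (P : S.vocab.Relations n) (ts : Fin n → S.vocab.Term ℕ) : Formula S
  | neg (φ : Formula S) : Formula S
  | conj (φ ψ : Formula S) : Formula S
  | ex (x : ℕ) (φ : Formula S) : Formula S
  | pref (X : S.indices) (φ ψ : Formula S) : Formula S

/-- The free variables of a formula. -/
def Formula.freeVars {S : Signature.{u, v}} : Formula S → Finset ℕ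
  | .equal t₁ t₂ => t₁.varFinset ∪ t₂.varFinset
  | .rel _ ts => Finset.univ.biUnion fun i => (ts i).varFinset
  | .neg φ => φ.freeVars
  | .conj φ ψ => φ.freeVars ∪ ψ.freeVars
  | .ex x φ => φ.freeVars.erase x
  | .pref _ φ ψ => φ.freeVars ∪ ψ.freeVars

/-- A sentence (closed formula) has no free variables. -/
def Formula.IsSentence {S : Signature.{u, v}} (φ : Formula S) : Prop :=
  φ.freeVars = ∅

/-- A preorder model `⟨D, W, t, ⊵, s⟩` for a signature. -/
structure PreorderModel (S : Signature.{u, v}) where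
  /-- the domain -/
  D : Type wD
  /-- the worlds -/
  W : Type wW
  nonempty_D : Nonempty D
  nonempty_W : Nonempty W
  /-- the extension over `D` of each predicate and each function symbol, at each world -/
  t : W → S.vocab.Structure D
  /-- the relation `⊵_X`, a total preorder of the worlds for each utility index `X` -/
  geq : S.indices → W → W → Prop
  geq_refl : ∀ X w, geq X w w
  geq_trans : ∀ X w₁ w₂ w₃, geq X w₁ w₂ → geq X w₂ w₃ → geq X w₁ w₃
  geq_total : ∀ X w₁ w₂, geq X w₁ w₂ ∨ geq X w₂ w₁
  /-- the selection function, on worlds and nonempty sets of worlds -/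
  s : W → {A : Set W // A.Nonempty} → W
  s_mem : ∀ w A, s w A ∈ A.1

namespace PreorderModel

variable {S : Signature.{u, v}}

/-- The value of a term at a world under an assignment. -/
def termVal (M : PreorderModel.{u, v, wD, wW} S) (w : M.W) (d : ℕ → M.D)
    (τ : S.vocab.Term ℕ) : M.D :=
  letI := M.t w
  τ.realize d

/-- The proposition (set of worlds) that a formula expresses in a model under an assignment. A
preference formula expresses the empty proposition if one of its two parts does. -/
def meaning (M : PreorderModel.{u, v, wD, wW} S) : Formula S → (ℕ → M.D) → Set M.W
  | .equal t₁ t₂, d => {w | M.termVal w d t₁ = M.termVal w d t₂}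
  | .rel P ts, d => {w | (M.t w).RelMap P fun i => M.termVal w d (ts i)}
  | .neg φ, d => (M.meaning φ d)ᶜ
  | .conj φ ψ, d => M.meaning φ d ∩ M.meaning ψ d
  | .ex x φ, d => {w | ∃ a : M.D, w ∈ M.meaning φ (Function.update d x a)}
  | .pref X φ ψ, d =>
      {w | ∃ (hφ : (M.meaning φ d).Nonempty) (hψ : (M.meaning ψ d).Nonempty),
        M.geq X (M.s w ⟨M.meaning φ d, hφ⟩) (M.s w ⟨M.meaning ψ d, hψ⟩)}

/-- The assignment-invariant core of the proposition that a formula expresses. -/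
def proposition (M : PreorderModel.{u, v, wD, wW} S) (φ : Formula S) : Set M.W :=
  ⋂ d : ℕ → M.D, M.meaning φ d

/-- A formula is true in a model if it holds at all worlds (under all assignments). -/
def Models (M : PreorderModel.{u, v, wD, wW} S) (φ : Formula S) : Prop :=
  M.proposition φ = Set.univ

end PreorderModel

end QuantPref

/-!
The proof combines an ultrapower with a Löwenheim–Skolem hull.

The selection function of a preorder model acts on arbitrary sets of worlds, but the meaning of
formulas depends only on its values at expressible propositions. A selection prescribed on some
family of sets, in a way that depends only on the set, extends to all nonempty sets
(`exists_selection`). Both constructions below prescribe the selection only where it is needed.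

*Upward.* In the ultrapower of `M` by an ultrafilter `U`, the selection is prescribed on the
internal sets, those given by a family of sets of worlds of `M` modulo `U`. By Łoś's theorem every
formula expresses an internal set there, so that the ultrapower makes the same formulas true
(`exists_modelsIff_ultrapower`). If `U` lives on the finite subsets of `A` and contains all cones,
then `A` embeds into the ultrapower of every infinite set (`exists_modelsIff_of_infinite`).

*Downward.* A pair of subsets of the domain and of the worlds which contains witnesses for
existential formulas, distinguishes different expressed propositions, and is closed under selection
from expressed propositions carries a preorder model with the same true sentences
(`exists_modelsIff_of_injective`). As there are only countably many formulas, each depending on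
finitely many variables, every infinite set generates such a pair without growing in cardinality
(`exists_modelsIff_card_le`).
-/

open Function Filter Cardinal

namespace QuantPref

variable {S : Signature.{u, v}}

/-! ### Countability of the set of formulas -/

theorem Signature.IsCountable.countable_formula (hS : S.IsCountable) : Countable (Formula S) := by
  obtain ⟨hL, hU⟩ := hS
  have hF : Countable (Σ n, S.vocab.Functions n) :=
    (Sum.inl_injective (α := Σ n, S.vocab.Functions n) (β := Σ n, S.vocab.Relations n)).countable
  have hR : Countable (Σ n, S.vocab.Relations n) :=
    (Sum.inr_injective (α := Σ n, S.vocab.Functions n) (β := Σ n, S.vocab.Relations n)).countable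
  have hR' (n : ℕ) : Countable (S.vocab.Relations n) :=
    (sigma_mk_injective (β := S.vocab.Relations) (i := n)).countable
  have hX : Countable S.indices := hU.to_subtype
  obtain ⟨e, he⟩ := exists_injective_nat (S.vocab.Term ℕ)
  obtain ⟨r, hr⟩ :=
    exists_injective_nat (Σ n, S.vocab.Relations n × (Fin n → S.vocab.Term ℕ))
  obtain ⟨x, hx⟩ := exists_injective_nat S.indices
  let code : Formula S → ℕ := fun φ => Formula.rec
    (fun t₁ t₂ => Nat.pair 0 (Nat.pair (e t₁) (e t₂)))
    (fun P ts => Nat.pair 1 (r ⟨_, P, ts⟩))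
    (fun _ a => Nat.pair 2 a)
    (fun _ _ a b => Nat.pair 3 (Nat.pair a b))
    (fun y _ a => Nat.pair 4 (Nat.pair y a))
    (fun X _ _ a b => Nat.pair 5 (Nat.pair (x X) (Nat.pair a b))) φ
  have hcode : Injective code := by
    intro φ
    induction φ with
    | equal t₁ t₂ =>
      intro ψ h
      cases ψ <;> simp_all [code, Nat.pair_eq_pair, he.eq_iff]
    | rel P ts =>
      intro ψ h
      cases ψ <;> simp [code, Nat.pair_eq_pair, hr.eq_iff] at h
      obtain ⟨rfl, h⟩ := h
      simp_all
    | neg φ ih =>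
      intro ψ h
      cases ψ <;> simp [code, Nat.pair_eq_pair] at h
      rw [ih h]
    | conj φ φ' ih ih' =>
      intro ψ h
      cases ψ <;> simp [code, Nat.pair_eq_pair] at h
      rw [ih h.1, ih' h.2]
    | ex y φ ih =>
      intro ψ h
      cases ψ <;> simp [code, Nat.pair_eq_pair] at h
      rw [h.1, ih h.2]
    | pref X φ φ' ih ih' =>
      intro ψ h
      cases ψ <;> simp [code, Nat.pair_eq_pair, hx.eq_iff] at h
      rw [h.1, ih h.2.1, ih' h.2.2]
  exact hcode.countable

/-! ### Dependence on free variables -/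

namespace PreorderModel

theorem termVal_congr (M : PreorderModel.{u, v, wD, wW} S) (w : M.W) {d d' : ℕ → M.D}
    {τ : S.vocab.Term ℕ} (h : ∀ n ∈ τ.varFinset, d n = d' n) :
    M.termVal w d τ = M.termVal w d' τ := by
  let _ := M.t w
  change τ.realize d = τ.realize d'
  rw [← FirstOrder.Language.Term.realize_restrictVar (f := id) (v := fun a => d a) d fun _ => rfl,
    ← FirstOrder.Language.Term.realize_restrictVar (f := id) (v := fun a => d' a) d' fun _ => rfl]
  congr 1
  funext a
  exact h a a.2

theorem meaning_congr (M : PreorderModel.{u, v, wD, wW} S) {φ : Formula S} {d d' : ℕ → M.D}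
    (h : ∀ n ∈ φ.freeVars, d n = d' n) : M.meaning φ d = M.meaning φ d' := by
  induction φ generalizing d d' with
  | equal t₁ t₂ =>
    ext w
    simp only [Formula.freeVars, Finset.mem_union] at h
    simp only [meaning, Set.mem_ofPred_eq]
    rw [M.termVal_congr w fun n hn => h n (.inl hn), M.termVal_congr w fun n hn => h n (.inr hn)]
  | rel P ts =>
    ext w
    simp only [Formula.freeVars, Finset.mem_biUnion, Finset.mem_univ, true_and] at h
    simp only [meaning, Set.mem_ofPred_eq]
    rw [funext fun i => M.termVal_congr w fun n hn => h n ⟨i, hn⟩]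
  | neg φ ih => simp only [meaning, ih h]
  | conj φ ψ ih ih' =>
    simp only [Formula.freeVars, Finset.mem_union] at h
    simp only [meaning, ih fun n hn => h n (.inl hn), ih' fun n hn => h n (.inr hn)]
  | ex x φ ih =>
    simp only [Formula.freeVars, Finset.mem_erase] at h
    ext w
    simp only [meaning, Set.mem_ofPred_eq]
    refine exists_congr fun a => ?_
    rw [ih]
    intro n hn
    by_cases hx : n = x
    · simp [hx]
    · simp [hx, h n ⟨hx, hn⟩]
  | pref X φ ψ ih ih' =>
    simp only [Formula.freeVars, Finset.mem_union] at h
    simp only [meaning, ih fun n hn => h n (.inl hn), ih' fun n hn => h n (.inr hn)]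

theorem models_iff (M : PreorderModel.{u, v, wD, wW} S) {φ : Formula S} :
    M.Models φ ↔ ∀ d w, w ∈ M.meaning φ d := by
  simp only [Models, proposition, Set.eq_univ_iff_forall, Set.mem_iInter]
  exact forall_comm

/-! ### Extending a selection prescribed on a family of sets -/

/-- A selection prescribed on the nonempty members of a family `F` of sets, in a way that depends
only on the set and not on its index, extends to a selection on all nonempty sets. -/
theorem exists_selection {W : Type*} {ι : Type*} (F : ι → Set W) (g : W → ι → W)
    (hg : ∀ w k, (F k).Nonempty → g w k ∈ F k) (hF : ∀ w k l, F k = F l → g w k = g w l) :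
    ∃ s : W → {A : Set W // A.Nonempty} → W,
      (∀ w A, s w A ∈ A.1) ∧ ∀ w k (h : (F k).Nonempty), s w ⟨F k, h⟩ = g w k := by
  classical
  refine ⟨fun w A => if h : ∃ k, F k = A.1 then g w h.choose else A.2.some, fun w A => ?_,
    fun w k h => ?_⟩
  · dsimp only
    split_ifs with h
    · have hA := hg w h.choose (by rw [h.choose_spec]; exact A.2)
      rwa [h.choose_spec] at hA
    · exact A.2.some_mem
  · have hk : ∃ l, F l = F k := ⟨k, rfl⟩
    refine (dif_pos hk).trans ?_
    exact hF w _ _ hk.choose_spec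

/-! ### Ultrapowers -/

section Ultrapower

variable {I : Type w} (U : Ultrafilter I)

/-- The ultrapower of a type. -/
abbrev Ultrapower (X : Type*) : Type _ := (U : Filter I).Product fun _ => X

variable {U}

namespace Ultrapower

/-- The element of the ultrapower that is represented by a family. -/
def of {X : Type*} (U : Ultrafilter I) (f : I → X) : Ultrapower U X :=
  Quotient.mk (productSetoid (U : Filter I) fun _ => X) f

/-- A family that represents an element of the ultrapower. -/
noncomputable def rep {X : Type*} (a : Ultrapower U X) : I → X := Quotient.out a

theorem of_eq_of {X : Type*} {f g : I → X} : of U f = of U g ↔ ∀ᶠ k in U, f k = g k :=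
  Quotient.eq (r := productSetoid (U : Filter I) fun _ => X)

theorem of_rep {X : Type*} (a : Ultrapower U X) : of U (rep a) = a :=
  Quotient.out_eq a

theorem rep_of {X : Type*} (f : I → X) : ∀ᶠ k in U, (of U f).rep k = f k :=
  of_eq_of.1 (of_rep _)

end Ultrapower

open Ultrapower

/-- The internal subset of the ultrapower of `W` that is represented by a family of subsets
of `W`. -/
def internalSet {W : Type wW} (U : Ultrafilter I) (A : I → Set W) : Set (Ultrapower U W) :=
  {w | ∀ᶠ k in U, w.rep k ∈ A k}

theorem of_mem_internalSet {W : Type wW} {A : I → Set W} {w : I → W} :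
    (of U w : Ultrapower U W) ∈ internalSet U A ↔ ∀ᶠ k in U, w k ∈ A k :=
  eventually_congr ((rep_of w).mono fun k hk => iff_of_eq (congrArg (· ∈ A k) hk))

theorem internalSet_nonempty_iff {W : Type wW} [Nonempty W] {A : I → Set W} :
    (internalSet U A).Nonempty ↔ ∀ᶠ k in U, (A k).Nonempty := by
  constructor
  · rintro ⟨w, hw⟩
    exact hw.mono fun k hk => ⟨_, hk⟩
  · intro h
    refine ⟨of U fun k => Classical.epsilon (· ∈ A k), of_mem_internalSet.2 ?_⟩
    exact h.mono fun k hk => Classical.epsilon_spec hk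

/-- A selection computed from a family of sets modulo `U` thus depends only on the internal set. -/
theorem eventuallyEq_of_internalSet_eq {W : Type wW} [Nonempty W] {A B : I → Set W}
    (h : internalSet U A = internalSet U B) : ∀ᶠ k in U, A k = B k := by
  by_contra hne
  rw [← Ultrafilter.eventually_not] at hne
  -- An element separating `A k` from `B k` at almost every `k` would separate the internal sets.
  let w : I → W := fun k => Classical.epsilon fun a => ¬(a ∈ A k ↔ a ∈ B k)
  have hw : ∀ᶠ k in U, ¬(w k ∈ A k ↔ w k ∈ B k) := hne.mono fun k hk =>
    Classical.epsilon_spec (p := fun a => ¬(a ∈ A k ↔ a ∈ B k)) <| by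
      by_contra! hk'
      exact hk (Set.ext hk')
  have hAB := Set.ext_iff.1 h (of U w)
  rw [of_mem_internalSet, of_mem_internalSet] at hAB
  by_cases hA : ∀ᶠ k in U, w k ∈ A k
  · obtain ⟨k, hk, hk₁, hk₂⟩ := (hw.and (hA.and (hAB.1 hA))).exists
    exact hk (iff_of_true hk₁ hk₂)
  · have hB := mt hAB.2 hA
    rw [← Ultrafilter.eventually_not] at hA hB
    obtain ⟨k, hk, hk₁, hk₂⟩ := (hw.and (hA.and hB)).exists
    exact hk (iff_of_false hk₁ hk₂)

/-- Łoś's theorem for preorder models, in the form that an ultrapower makes the same formulas true.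
The sorts of the ultrapower are the ultrapowers of the sorts. -/
theorem exists_modelsIff_ultrapower (U : Ultrafilter I) (M : PreorderModel.{u, v, wD, wW} S) :
    ∃ M' : PreorderModel.{u, v, max w wD, max w wW} S,
      M'.D = Ultrapower U M.D ∧ M'.W = Ultrapower U M.W ∧
      ∀ φ : Formula S, M.Models φ ↔ M'.Models φ := by
  classical
  have hD := M.nonempty_D
  have hW := M.nonempty_W
  obtain ⟨s, hs, hs'⟩ := exists_selection (internalSet (W := M.W) U)
    (fun w A => of U fun k => if h : (A k).Nonempty then M.s (w.rep k) ⟨A k, h⟩ else w.rep k)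
    (fun w A hA => of_mem_internalSet.2 <| (internalSet_nonempty_iff.1 hA).mono fun k hk => by
      simp only [hk, dite_true]
      exact M.s_mem _ ⟨A k, hk⟩)
    (fun w A B hAB => of_eq_of.2 <| (eventuallyEq_of_internalSet_eq hAB).mono fun k hk => by
      simp only [hk])
  let M' : PreorderModel.{u, v, max w wD, max w wW} S :=
    { D := Ultrapower U M.D
      W := Ultrapower U M.W
      nonempty_D := ⟨of U fun _ => hD.some⟩
      nonempty_W := ⟨of U fun _ => hW.some⟩
      t := fun w => @FirstOrder.Language.Ultraproduct.structure I (fun _ => M.D) U S.vocab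
        fun k => M.t (w.rep k)
      geq := fun X a b => ∀ᶠ k in U, M.geq X (a.rep k) (b.rep k)
      geq_refl := fun X a => .of_forall fun k => M.geq_refl _ _
      geq_trans := fun X a b c hab hbc =>
        (hab.and hbc).mono fun k hk => M.geq_trans _ _ _ _ hk.1 hk.2
      geq_total := fun X a b =>
        Ultrafilter.eventually_or.1 (.of_forall fun k => M.geq_total _ _ _)
      s := s
      s_mem := hs }
  have term (d : ℕ → I → M.D) (w : M'.W) (τ : S.vocab.Term ℕ) :
      M'.termVal w (fun n => of U (d n)) τ =
        of U fun k => M.termVal (rep w k) (fun n => d n k) τ :=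
    @FirstOrder.Language.Ultraproduct.term_realize_cast I (fun _ => M.D) U S.vocab
      (fun k => M.t (rep w k)) ℕ d τ
  -- Every formula expresses the internal set represented by the propositions it expresses in `M`.
  have los (φ : Formula S) (d : ℕ → I → M.D) :
      M'.meaning φ (fun n => of U (d n)) =
        internalSet U fun k => M.meaning φ fun n => d n k := by
    induction φ generalizing d with
    | equal t₁ t₂ =>
      ext w
      simp only [meaning, term, internalSet, Set.mem_ofPred_eq]
      exact of_eq_of
    | rel P ts =>
      ext w
      simp only [meaning, term, internalSet, Set.mem_ofPred_eq]
      exact @FirstOrder.Language.relMap_quotient_mk' S.vocab _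
        ((U : Filter I).productSetoid fun _ => M.D)
        (@FirstOrder.Language.Ultraproduct.setoidPrestructure I (fun _ => M.D) U S.vocab
          fun k => M.t (rep w k)) _ P _
    | neg φ ih =>
      simp only [meaning, ih]
      ext w
      exact Ultrafilter.eventually_not.symm
    | conj φ ψ ih ih' =>
      simp only [meaning, ih, ih']
      ext w
      exact eventually_and.symm
    | ex x φ ih =>
      have hupd (a : I → M.D) :
          M'.meaning φ (update (fun n => of U (d n)) x (of U a)) =
            internalSet U fun k => M.meaning φ (update (fun n => d n k) x (a k)) := by
        have h₁ : update (fun n => of U (d n)) x (of U a) = fun n => of U (update d x a n) :=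
          (comp_update (of U) d x a).symm
        have h₂ (k : I) : update (fun n => d n k) x (a k) = fun n => update d x a n k :=
          (comp_update (fun f : I → M.D => f k) d x a).symm
        simp only [h₂, ← ih, ← h₁]
      ext w
      simp only [meaning, Set.mem_ofPred_eq]
      constructor
      · rintro ⟨a, ha⟩
        have ha' := (Set.ext_iff.1 (hupd (rep a)) w).1 (by rw [of_rep]; exact ha)
        exact ha'.mono fun k hk => ⟨_, hk⟩
      · intro h
        refine ⟨of U fun k => Classical.epsilon fun a =>
          rep w k ∈ M.meaning φ (update (fun n => d n k) x a), ?_⟩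
        refine (Set.ext_iff.1 (hupd _) w).2 ?_
        exact h.mono fun k hk => Classical.epsilon_spec hk
    | pref X φ ψ ih ih' =>
      ext w
      simp only [meaning, ih, ih', Set.mem_ofPred_eq]
      have hgeq (hφ : (internalSet U fun k => M.meaning φ fun n => d n k).Nonempty)
          (hψ : (internalSet U fun k => M.meaning ψ fun n => d n k).Nonempty) :
          M'.geq X (s w ⟨_, hφ⟩) (s w ⟨_, hψ⟩) ↔ ∀ᶠ k in U, ∃ h₁ h₂,
            M.geq X (M.s (rep w k) ⟨M.meaning φ fun n => d n k, h₁⟩)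
              (M.s (rep w k) ⟨M.meaning ψ fun n => d n k, h₂⟩) := by
        rw [hs', hs']
        refine eventually_congr ?_
        filter_upwards [internalSet_nonempty_iff.1 hφ, internalSet_nonempty_iff.1 hψ,
          rep_of (U := U) _, rep_of (U := U) _] with k h₁ h₂ h₃ h₄
        rw [h₃, h₄, dif_pos h₁, dif_pos h₂]
        simp only [h₁, h₂, exists_true_left]
      constructor
      · rintro ⟨hφ, hψ, h⟩
        exact (hgeq hφ hψ).1 h
      · intro h
        have hφ := internalSet_nonempty_iff.2 (h.mono fun k hk => hk.choose)
        have hψ := internalSet_nonempty_iff.2 (h.mono fun k hk => hk.choose_spec.choose)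
        exact ⟨hφ, hψ, (hgeq hφ hψ).2 h⟩
  refine ⟨M', rfl, rfl, fun φ => ?_⟩
  rw [models_iff, models_iff]
  constructor
  · intro h d w
    have hd : d = fun n => of U (rep (d n)) := funext fun n => (of_rep (d n)).symm
    rw [hd, los]
    exact .of_forall fun k => h _ _
  · intro h d w
    have hw := h (fun n => of U fun _ => d n) (of U fun _ => w)
    rw [los] at hw
    exact (of_mem_internalSet.1 hw).exists.choose_spec

/-- If the ultrafilter on the finite subsets of `A` contains all cones, then `A` embeds into every
ultrapower of an infinite set. -/
theorem exists_injective_ultrapower {A : Type w} {U : Ultrafilter (Finset A)}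
    (hU : (U : Filter (Finset A)) ≤ atTop) (X : Type wD) [Infinite X] :
    ∃ f : A → Ultrapower U X, Injective f := by
  have (F : Finset A) : ∃ f : A → X, Set.InjOn f F := by
    classical
    refine ⟨fun a => Infinite.natEmbedding X (if h : a ∈ F then F.equivFin ⟨a, h⟩ else 0), ?_⟩
    intro a ha b hb hab
    have ha' : a ∈ F := ha
    have hb' : b ∈ F := hb
    simpa [ha', hb', Fin.val_inj] using hab
  choose f hf using this
  refine ⟨fun a => of U fun F => f F a, fun a b hab => ?_⟩
  classical
  obtain ⟨F, hF, hF'⟩ := ((of_eq_of.1 hab).and (hU (eventually_ge_atTop {a, b}))).exists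
  exact hf F (hF' (by simp)) (hF' (by simp)) hF

end Ultrapower

/-- The upward half: a preorder model with the same true formulas in which `A` embeds into both
sorts, as far as they are infinite in the given model. -/
theorem exists_modelsIff_of_infinite (M : PreorderModel.{u, v, wD, wW} S) (A : Type w) :
    ∃ M' : PreorderModel.{u, v, max w wD, max w wW} S,
      (Infinite M.D → ∃ f : A → M'.D, Injective f) ∧
      (Infinite M.W → ∃ f : A → M'.W, Injective f) ∧
      ∀ φ : Formula S, M.Models φ ↔ M'.Models φ := by
  classical
  obtain ⟨M', hD, hW, h⟩ := exists_modelsIff_ultrapower (.of (atTop : Filter (Finset A))) M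
  have hU := Ultrafilter.of_le (atTop : Filter (Finset A))
  refine ⟨M', fun _ => ?_, fun _ => ?_, h⟩
  · rw [hD]
    exact exists_injective_ultrapower hU M.D
  · rw [hW]
    exact exists_injective_ultrapower hU M.W

/-! ### Elementary submodels -/

/-- A Tarski–Vaught criterion. The sets of individuals and worlds of the submodel are presented as
the images of maps, so that they may live in another universe. Only the map on individuals has to be
injective, because identity of worlds is not expressible. -/
theorem exists_modelsIff_of_injective (M : PreorderModel.{u, v, wD, wW} S) {D' : Type*}
    {W' : Type*} [Nonempty D'] [Nonempty W'] {i : D' → M.D} {j : W' → M.W} (hi : Injective i)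
    (hex : ∀ φ x d w, j w ∈ M.meaning (.ex x φ) (i ∘ d) →
      ∃ a, j w ∈ M.meaning φ (update (i ∘ d) x (i a)))
    (hdiff : ∀ φ ψ d e, j ⁻¹' M.meaning φ (i ∘ d) = j ⁻¹' M.meaning ψ (i ∘ e) →
      M.meaning φ (i ∘ d) = M.meaning ψ (i ∘ e))
    (hsel : ∀ φ d w (h : (M.meaning φ (i ∘ d)).Nonempty),
      ∃ w', j w' = M.s (j w) ⟨M.meaning φ (i ∘ d), h⟩) :
    ∃ M' : PreorderModel S, M'.D = D' ∧ M'.W = W' ∧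
      ∀ φ : Formula S, φ.IsSentence → (M.Models φ ↔ M'.Models φ) := by
  classical
  -- A proposition with no world in the submodel coincides with a contradiction, hence is empty.
  have hne (φ : Formula S) (d : ℕ → D') :
      (j ⁻¹' M.meaning φ (i ∘ d)).Nonempty ↔ (M.meaning φ (i ∘ d)).Nonempty := by
    refine ⟨fun ⟨w, hw⟩ => ⟨_, hw⟩, fun h => ?_⟩
    by_contra h'
    have := hdiff φ (.conj φ (.neg φ)) d d (by
      rw [Set.not_nonempty_iff_eq_empty.1 h']
      simp [meaning])
    rw [this] at h
    simp [meaning] at h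
  -- The graph of a function symbol is expressed by an equation, so the existential witnesses
  -- already make the submodel closed under function symbols.
  have hfun (w : W') (n : ℕ) (f : S.vocab.Functions n) (x : Fin n → D') :
      ∃ y, i y = (M.t (j w)).funMap f (i ∘ x) := by
    let τ : S.vocab.Term ℕ := .func f fun k => .var k
    let d : ℕ → D' := fun k => if h : k < n then x ⟨k, h⟩ else Classical.arbitrary D'
    have hτ (b : M.D) : M.termVal (j w) (update (i ∘ d) n b) τ =
        (M.t (j w)).funMap f (i ∘ x) := by
      change (M.t (j w)).funMap f _ = _
      congr 1
      funext k
      change update (i ∘ d) n b k = _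
      simp [d, k.2.ne]
    obtain ⟨a, ha⟩ := hex (.equal (.var n) τ) n d w
      ⟨(M.t (j w)).funMap f (i ∘ x), by
        simp only [meaning, Set.mem_ofPred_eq, hτ]
        exact update_self n _ (i ∘ d)⟩
    simp only [meaning, Set.mem_ofPred_eq, hτ] at ha
    exact ⟨a, by rw [← ha]; exact (update_self n (i a) (i ∘ d)).symm⟩
  choose F hF using hfun
  obtain ⟨s, hs, hs'⟩ := exists_selection
    (fun p : Formula S × (ℕ → D') => j ⁻¹' M.meaning p.1 (i ∘ p.2))
    (fun w p => if h : (M.meaning p.1 (i ∘ p.2)).Nonempty then (hsel p.1 p.2 w h).choose else w)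
    (fun w p hp => by
      have hp' := (hne _ _).1 hp
      rw [dif_pos hp', Set.mem_preimage, (hsel p.1 p.2 w hp').choose_spec]
      exact M.s_mem _ ⟨_, hp'⟩)
    (fun w p q hpq => by
      have := hdiff _ _ _ _ hpq
      simp only [this])
  let M' : PreorderModel S :=
    { D := D'
      W := W'
      nonempty_D := inferInstance
      nonempty_W := inferInstance
      t := fun w => ⟨fun {n} => F w n, fun P x => (M.t (j w)).RelMap P (i ∘ x)⟩
      geq := fun X a b => M.geq X (j a) (j b)
      geq_refl := fun X a => M.geq_refl _ _
      geq_trans := fun X a b c => M.geq_trans _ _ _ _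
      geq_total := fun X a b => M.geq_total _ _ _
      s := s
      s_mem := hs }
  have term (d : ℕ → D') (w : W') (τ : S.vocab.Term ℕ) :
      i (M'.termVal w d τ) = M.termVal (j w) (i ∘ d) τ := by
    induction τ with
    | var n => rfl
    | func f ts ih =>
      change i (F w _ f fun k => M'.termVal w d (ts k)) =
        (M.t (j w)).funMap f fun k => M.termVal (j w) (i ∘ d) (ts k)
      rw [hF]
      congr 1
      exact funext ih
  have key (φ : Formula S) (d : ℕ → D') : M'.meaning φ d = j ⁻¹' M.meaning φ (i ∘ d) := by
    induction φ generalizing d with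
    | equal t₁ t₂ =>
      ext w
      simp only [meaning, Set.mem_preimage, Set.mem_ofPred_eq, ← term]
      exact hi.eq_iff.symm
    | rel P ts =>
      ext w
      simp only [meaning, Set.mem_preimage, Set.mem_ofPred_eq, ← term]
      rfl
    | neg φ ih => simp only [meaning, ih, Set.preimage_compl]
    | conj φ ψ ih ih' => simp only [meaning, ih, ih', Set.preimage_inter]
    | ex x φ ih =>
      ext w
      have hupd (a : D') : i ∘ update d x a = update (i ∘ d) x (i a) := comp_update ..
      simp only [meaning, ih, hupd]
      exact ⟨fun ⟨a, ha⟩ => ⟨i a, ha⟩, fun h => hex φ x d w h⟩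
    | pref X φ ψ ih ih' =>
      ext w
      simp only [meaning, ih, ih', Set.mem_preimage, Set.mem_ofPred_eq, hne]
      refine exists_congr fun hφ => exists_congr fun hψ => ?_
      change M.geq X (j (s w ⟨_, _⟩)) (j (s w ⟨_, _⟩)) ↔ _
      rw [hs' w (φ, d) ((hne _ _).2 hφ), hs' w (ψ, d) ((hne _ _).2 hψ), dif_pos hφ, dif_pos hψ,
        (hsel φ d w hφ).choose_spec, (hsel ψ d w hψ).choose_spec]
  refine ⟨M', rfl, rfl, fun φ hφ => ?_⟩
  rw [models_iff, models_iff]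
  constructor
  · intro h d w
    rw [key]
    exact h _ _
  · intro h d w
    let d' : ℕ → D' := fun _ => Classical.arbitrary D'
    have hd : M.meaning φ d = M.meaning φ (i ∘ d') := M.meaning_congr fun n hn => by
      rw [hφ] at hn
      simp at hn
    have : M.meaning (.neg φ) (i ∘ d') = ∅ := by
      rw [← Set.not_nonempty_iff_eq_empty, ← hne, ← key]
      rintro ⟨w', hw'⟩
      exact hw' (h d' w')
    rw [hd]
    by_contra hw
    exact Set.eq_empty_iff_forall_notMem.1 this w hw

end PreorderModel

/-! ### Hulls under countably many operations -/

/-- A set listed by an infinite type `A` generates a set no larger than `A` under countably many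
operations, each taking a family of arguments indexed by a countable type. Closure is claimed only
at those families at which finitely many arguments already determine the value of the operation. -/
theorem exists_hull {E : Type u} {A : Type v} [Infinite A] {ι : Type} {K : Type w} [Countable K]
    [Countable ι] (op : K → (ι → E) → E) (g : A → E) :
    ∃ C : Set E, Nonempty (C ↪ A) ∧ Set.range g ⊆ C ∧
      ∀ k (a : ι → E), (∀ l, a l ∈ C) →
        (∃ F : Finset ι, ∀ b : ι → E, (∀ l ∈ F, b l = a l) → op k b = op k a) → op k a ∈ C := by
  classical
  obtain ⟨a₀⟩ : Nonempty A := inferInstance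
  -- An `n`-ary function symbol is an operation together with the places of its `n` arguments.
  let L : FirstOrder.Language := ⟨fun n => K × (Fin n → ι), fun _ => Empty⟩
  let _ : L.Structure E :=
    ⟨fun f x => op f.1 fun l => if h : ∃ m, f.2 m = l then x h.choose else g a₀,
      fun P => P.elim⟩
  have hcl := FirstOrder.Language.Substructure.subset_closure (L := L) (s := Set.range g)
  refine ⟨FirstOrder.Language.Substructure.closure L (Set.range g), ?_, hcl, ?_⟩
  · have hcount : Countable (Σ n, L.Functions n) :=
      inferInstanceAs (Countable (Σ n, K × (Fin n → ι)))
    refine lift_mk_le.{w}.1 ?_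
    have h₁ := lift_le.{v}.2 <|
      FirstOrder.Language.Substructure.lift_card_closure_le (L := L) (s := Set.range g)
    have h₂ : lift.{max u v} #(Σ n, L.Functions n) ≤ ℵ₀ := lift_le_aleph0.2 mk_le_aleph0
    have h₃ := lift_le.{w}.2 (mk_range_le_lift (f := g))
    have h₄ : ℵ₀ ≤ lift.{max u w} #A := aleph0_le_lift.2 (aleph0_le_mk A)
    simp only [lift_max, lift_add, lift_lift, lift_aleph0] at h₁ h₃
    exact h₁.trans (max_le h₄ (add_le_of_le h₄ h₃ (h₂.trans h₄)))
  · rintro k a ha ⟨F, hF⟩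
    have hmem := (FirstOrder.Language.Substructure.closure L (Set.range g)).fun_mem
      (n := F.card) (k, fun m => (F.equivFin.symm m : ι)) (fun m => a (F.equivFin.symm m))
      fun m => ha _
    have heq : op k (fun l => if h : ∃ m, (F.equivFin.symm m : ι) = l then
        a (F.equivFin.symm h.choose) else g a₀) = op k a := by
      refine hF _ fun l hl => ?_
      have h : ∃ m, (F.equivFin.symm m : ι) = l := ⟨F.equivFin ⟨l, hl⟩, by simp⟩
      rw [dif_pos h, h.choose_spec]
    rw [← heq]
    exact hmem

namespace PreorderModel

/-- The downward half: individuals and worlds listed by an infinite type `A` lie in a submodel with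
the same true sentences, both sorts of which are no larger than `A`. -/
theorem exists_modelsIff_card_le (hS : S.IsCountable) (M : PreorderModel.{u, v, wD, wW} S)
    {A : Type w} [Infinite A] (g : A → M.D ⊕ M.W) :
    ∃ (M' : PreorderModel.{u, v, w, w} S) (i : M'.D → M.D) (j : M'.W → M.W),
      (∀ a x, g a = .inl x → x ∈ Set.range i) ∧ (∀ a x, g a = .inr x → x ∈ Set.range j) ∧
      #M'.D ≤ #A ∧ #M'.W ≤ #A ∧
      ∀ φ : Formula S, φ.IsSentence → (M.Models φ ↔ M'.Models φ) := by
  classical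
  have hform := hS.countable_formula
  obtain ⟨d₀⟩ := M.nonempty_D
  obtain ⟨w₀⟩ := M.nonempty_W
  have hD := M.nonempty_D
  have hW := M.nonempty_W
  let toD : M.D ⊕ M.W → M.D := Sum.elim id fun _ => d₀
  let toW : M.D ⊕ M.W → M.W := Sum.elim (fun _ => w₀) id
  -- The arguments of an operation are a world and two assignments.
  let world (a : Option (ℕ ⊕ ℕ) → M.D ⊕ M.W) : M.W := toW (a none)
  let fst (a : Option (ℕ ⊕ ℕ) → M.D ⊕ M.W) (n : ℕ) : M.D := toD (a (some (.inl n)))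
  let snd (a : Option (ℕ ⊕ ℕ) → M.D ⊕ M.W) (n : ℕ) : M.D := toD (a (some (.inr n)))
  -- A witness for an existential formula, a world that distinguishes two propositions, and the
  -- world selected from a proposition.
  let wit (φ : Formula S) (x : ℕ) (w : M.W) (d : ℕ → M.D) : M.D :=
    Classical.epsilon fun b => w ∈ M.meaning φ (update d x b)
  let diff (φ ψ : Formula S) (d e : ℕ → M.D) : M.W :=
    Classical.epsilon fun w => ¬(w ∈ M.meaning φ d ↔ w ∈ M.meaning ψ e)
  let sel (φ : Formula S) (w : M.W) (d : ℕ → M.D) : M.W :=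
    if h : (M.meaning φ d).Nonempty then M.s w ⟨M.meaning φ d, h⟩ else w
  let op : ((Formula S × ℕ) ⊕ (Formula S × Formula S) ⊕ Formula S) →
      (Option (ℕ ⊕ ℕ) → M.D ⊕ M.W) → M.D ⊕ M.W := fun k a => match k with
    | .inl (φ, x) => .inl (wit φ x (world a) (fst a))
    | .inr (.inl (φ, ψ)) => .inr (diff φ ψ (fst a) (snd a))
    | .inr (.inr φ) => .inr (sel φ (world a) (fst a))
  obtain ⟨C, ⟨c⟩, hgC, hC⟩ := exists_hull op g
  have hop (k) (a : Option (ℕ ⊕ ℕ) → M.D ⊕ M.W) (ha : ∀ l, a l ∈ C) : op k a ∈ C := by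
    refine hC k a ha ?_
    rcases k with ⟨φ, x⟩ | ⟨φ, ψ⟩ | φ
    · refine ⟨insert none (φ.freeVars.image fun n => some (.inl n)), fun b hb => ?_⟩
      have hw : world b = world a := congrArg toW (hb _ (by simp))
      have hd (y : M.D) : M.meaning φ (update (fst b) x y) = M.meaning φ (update (fst a) x y) :=
        M.meaning_congr fun n hn => by
          have : fst b n = fst a n := congrArg toD (hb _ (by simp [hn]))
          simp [update_apply, this]
      simp only [op, wit, hw, hd]
    · refine ⟨φ.freeVars.image (fun n => some (.inl n)) ∪
        ψ.freeVars.image (fun n => some (.inr n)), fun b hb => ?_⟩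
      have hd : M.meaning φ (fst b) = M.meaning φ (fst a) :=
        M.meaning_congr fun n hn => congrArg toD (hb _ (by simp [hn]))
      have he : M.meaning ψ (snd b) = M.meaning ψ (snd a) :=
        M.meaning_congr fun n hn => congrArg toD (hb _ (by simp [hn]))
      simp only [op, diff, hd, he]
    · refine ⟨insert none (φ.freeVars.image fun n => some (.inl n)), fun b hb => ?_⟩
      have hw : world b = world a := congrArg toW (hb _ (by simp))
      have hd : M.meaning φ (fst b) = M.meaning φ (fst a) :=
        M.meaning_congr fun n hn => congrArg toD (hb _ (by simp [hn]))
      simp only [op, sel, hw, hd]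
  -- The two sorts of the hull, moved to the universe of `A` as subsets of `A`.
  let cD : {x // Sum.inl x ∈ C} → A := fun x => c ⟨_, x.2⟩
  let cW : {x // Sum.inr x ∈ C} → A := fun x => c ⟨_, x.2⟩
  have hcD : Injective cD := fun x y h => by
    simpa [cD, Subtype.ext_iff] using h
  have hcW : Injective cW := fun x y h => by
    simpa [cW, Subtype.ext_iff] using h
  let eD := Equiv.ofInjective cD hcD
  let eW := Equiv.ofInjective cW hcW
  let i : Set.range cD → M.D := fun y => (eD.symm y).1
  let j : Set.range cW → M.W := fun y => (eW.symm y).1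
  have hiC (y) : Sum.inl (i y) ∈ C := (eD.symm y).2
  have hjC (y) : Sum.inr (j y) ∈ C := (eW.symm y).2
  have hiR (x) (hx : Sum.inl x ∈ C) : ∃ y, i y = x := ⟨eD ⟨x, hx⟩, by simp [i]⟩
  have hjR (x) (hx : Sum.inr x ∈ C) : ∃ y, j y = x := ⟨eW ⟨x, hx⟩, by simp [j]⟩
  obtain ⟨a₀⟩ : Nonempty A := inferInstance
  have ha₀ : g a₀ ∈ C := hgC ⟨a₀, rfl⟩
  let φ₀ : Formula S := .equal (.var 0) (.var 0)
  have : Nonempty (Set.range cD) :=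
    ⟨(hiR _ (hop (.inl (φ₀, 0)) (fun _ => g a₀) fun _ => ha₀)).choose⟩
  have : Nonempty (Set.range cW) :=
    ⟨(hjR _ (hop (.inr (.inl (φ₀, φ₀))) (fun _ => g a₀) fun _ => ha₀)).choose⟩
  -- The argument sequence made of a world and two assignments.
  let args (w : M.W) (d e : ℕ → M.D) : Option (ℕ ⊕ ℕ) → M.D ⊕ M.W
    | none => .inr w
    | some (.inl n) => .inl (d n)
    | some (.inr n) => .inl (e n)
  have hargs (w : Set.range cW) (d e : ℕ → Set.range cD) (l) :
      args (j w) (i ∘ d) (i ∘ e) l ∈ C := by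
    rcases l with _ | n | n
    · exact hjC w
    · exact hiC (d n)
    · exact hiC (e n)
  obtain ⟨M', hMD, hMW, hM⟩ := M.exists_modelsIff_of_injective (i := i) (j := j)
    (Subtype.val_injective.comp eD.symm.injective)
    (fun φ x d w h => by
      obtain ⟨y, hy⟩ := hiR _ (hop (.inl (φ, x)) _ (hargs w d d))
      refine ⟨y, ?_⟩
      rw [hy]
      exact Classical.epsilon_spec (p := fun b => j w ∈ M.meaning φ (update (i ∘ d) x b)) h)
    (fun φ ψ d e h => by
      obtain ⟨y, hy⟩ := hjR _ (hop (.inr (.inl (φ, ψ))) _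
        (hargs (Classical.arbitrary _) d e))
      by_contra hne
      have hex : ∃ w, ¬(w ∈ M.meaning φ (i ∘ d) ↔ w ∈ M.meaning ψ (i ∘ e)) := by
        by_contra! h'
        exact hne (Set.ext h')
      refine Classical.epsilon_spec hex ?_
      change diff φ ψ (i ∘ d) (i ∘ e) ∈ _ ↔ diff φ ψ (i ∘ d) (i ∘ e) ∈ _
      have hy' : j y = diff φ ψ (i ∘ d) (i ∘ e) := hy
      rw [← hy']
      exact Set.ext_iff.1 h y)
    (fun φ d w h => by
      obtain ⟨y, hy⟩ := hjR _ (hop (.inr (.inr φ)) _ (hargs w d d))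
      exact ⟨y, hy.trans (dif_pos h)⟩)
  obtain ⟨D', W', _, _, _, _, _, _, _, _, _⟩ := M'
  obtain rfl : D' = _ := hMD
  obtain rfl : W' = _ := hMW
  exact ⟨_, i, j, fun a x ha => Set.mem_range.2 (hiR x (ha ▸ hgC ⟨a, rfl⟩)),
    fun a x ha => Set.mem_range.2 (hjR x (ha ▸ hgC ⟨a, rfl⟩)), mk_subtype_le _, mk_subtype_le _, hM⟩

end PreorderModel

end QuantPref

open QuantPref PreorderModel in
theorem proposition4p6 (S : QuantPref.Signature.{u, v}) (hS : S.IsCountable)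
    (M : QuantPref.PreorderModel.{u, v, wD, wW} S) :
    (Infinite M.W → ∀ κ : Cardinal.{w}, Cardinal.aleph0 ≤ κ →
      ∃ M' : QuantPref.PreorderModel.{u, v, w, w} S, Cardinal.mk M'.W = κ ∧
        ∀ φ : QuantPref.Formula S, φ.IsSentence → (M.Models φ ↔ M'.Models φ)) ∧
    (Infinite M.D → ∀ κ : Cardinal.{w}, Cardinal.aleph0 ≤ κ →
      ∃ M' : QuantPref.PreorderModel.{u, v, w, w} S, Cardinal.mk M'.D = κ ∧
        ∀ φ : QuantPref.Formula S, φ.IsSentence → (M.Models φ ↔ M'.Models φ)) := by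
  refine ⟨fun hinf κ hκ => ?_, fun hinf κ hκ => ?_⟩
  all_goals
    have : Infinite κ.out := infinite_iff.2 (by rwa [mk_out])
    obtain ⟨N, hND, hNW, hN⟩ := exists_modelsIff_of_infinite M κ.out
  · obtain ⟨f, hf⟩ := hNW hinf
    obtain ⟨M', i, j, -, hj, -, hle, hM'⟩ :=
      exists_modelsIff_card_le hS N fun a => Sum.inr (f a)
    choose r hr using fun a => hj a _ rfl
    have hr' : Injective r := fun a b h => hf (by rw [← hr a, ← hr b, h])
    exact ⟨M', (hle.antisymm (mk_le_of_injective hr')).trans (mk_out κ),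
      fun φ hφ => (hN φ).trans (hM' φ hφ)⟩
  · obtain ⟨f, hf⟩ := hND hinf
    obtain ⟨M', i, j, hi, -, hle, -, hM'⟩ :=
      exists_modelsIff_card_le hS N fun a => Sum.inl (f a)
    choose r hr using fun a => hi a _ rfl
    have hr' : Injective r := fun a b h => hf (by rw [← hr a, ← hr b, h])
    exact ⟨M', (hle.antisymm (mk_le_of_injective hr')).trans (mk_out κ),
      fun φ hφ => (hN φ).trans (hM' φ hφ)⟩
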